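/- Let $G=(V,E)$ be a finite connected simple graph. Its edge polytope $\mathcal P_G\subset\mathbb R^V$ is the convex hull of the points $\mathbf e_u+\mathbf e_v$, $uv\in E$; put $i_G(0)=1$ and $i_G(m)=|m\mathcal P_G\cap\mathbb Z^V|$ for $m\ge 1$, and let $H_G(t)=\sum_{m\ge 0} i_G(m)t^m$ be the Ehrhart series of $G$ (and likewise for every subgraph of $G$, on its own vertex set). A biconnected component of $G$ is a maximal connected nonempty subgraph that remains connected (or becomes empty) when any one vertex is removed; a single edge counts as biconnected. (a) If $G$ contains an odd cycle, let $G_0$ be a connected subgraph of $G$ that is a union of biconnected components of $G$, contains all biconnected components having an odd cycle, and is minimal with these properties, and let $B_1,\dots,B_{r'}$ be the biconnected components of $G$ that are not contained in $G_0$. Then $$H_G(t)=H_{G_0}(t)\prod_{i=1}^{r'}H_{B_i}(t).$$ (b) If $G$ contains no odd cycle and $B_1,\dots,B_r$ are all its biconnected components, then $$H_G(t)=\prod_{i=1}^{r}H_{B_i}(t).$$ -/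

import Mathlib

open scoped Pointwise

namespace EdgePolytope

noncomputable section

/-- The edge polytope of a graph: the convex hull in `ℝ^V` of the points `e_u + e_v`,
where `uv` runs over the edges. -/
def edgePolytope {V : Type*} (G : SimpleGraph V) : Set (V → ℝ) :=
  open Classical in
  convexHull ℝ {x | ∃ u v, G.Adj u v ∧ x = Pi.single u 1 + Pi.single v 1}

/-- The number of integer points in the `m`-th dilate of the edge polytope,
with the convention that the value at `m = 0` is `1`. -/
def ehrhartCount {V : Type*} (G : SimpleGraph V) (m : ℕ) : ℕ :=
  if m = 0 then 1
  else Set.ncard {z : V → ℤ | (fun v => (z v : ℝ)) ∈ (m : ℝ) • edgePolytope G}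

/-- The Ehrhart series `∑ i_G(m) t^m` of the edge polytope. -/
def ehrhartSeries {V : Type*} (G : SimpleGraph V) : PowerSeries ℤ :=
  PowerSeries.mk fun m => (ehrhartCount G m : ℤ)

/-- The graph contains a cycle of odd length. -/
def HasOddCycle {V : Type*} (G : SimpleGraph V) : Prop :=
  ∃ (v : V) (c : G.Walk v v), c.IsCycle ∧ Odd c.length

/-- A subgraph is biconnected if it is connected (in particular nonempty) and stays connected,
or becomes empty, when any one vertex is removed. A single edge is biconnected. -/
def IsBiconnected {V : Type*} {G : SimpleGraph V} (H : G.Subgraph) : Prop :=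
  H.Connected ∧ ∀ v : V, (H.deleteVerts {v}).Preconnected

/-- A biconnected component (block): a maximal biconnected subgraph. -/
def IsBlock {V : Type*} {G : SimpleGraph V} (B : G.Subgraph) : Prop :=
  Maximal IsBiconnected B

/-- A connected subgraph that is a union of biconnected components of `G`, among them all those
that contain an odd cycle. -/
def IsConnectedOddCover {V : Type*} {G : SimpleGraph V} (H : G.Subgraph) : Prop :=
  H.Connected ∧
  (∃ S : Set G.Subgraph, (∀ B ∈ S, IsBlock B) ∧ H = sSup S) ∧
  ∀ B : G.Subgraph, IsBlock B → HasOddCycle B.coe → B ≤ H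

/-- The oddments subgraph `G₀`: a minimal connected union of biconnected components containing all
biconnected components that have odd cycles. -/
def IsOddmentsSubgraph {V : Type*} {G : SimpleGraph V} (G₀ : G.Subgraph) : Prop :=
  Minimal IsConnectedOddCover G₀

/-- The finite set of all biconnected components of a finite graph. -/
def blocks {V : Type*} [Finite V] (G : SimpleGraph V) : Finset G.Subgraph :=
  (Set.toFinite {B : G.Subgraph | IsBlock B}).toFinset

/-- The biconnected components `B₁, …, B_{r'}` that are not part of `G₀`. -/
def blocksOutside {V : Type*} [Finite V] {G : SimpleGraph V} (G₀ : G.Subgraph) :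
    Finset G.Subgraph :=
  (Set.toFinite {B : G.Subgraph | IsBlock B ∧ ¬ B ≤ G₀}).toFinset

end

end EdgePolytope

open EdgePolytope

/-! The count $i_G(m)$ is the number of integer points at height $m$ of the cone over the edge
polytope, and the cone of a union of graphs is the sum of their cones (`mem_coneSlice_sup`). Suppose
$G_1$ and a bipartite $G_2$ share at most the vertex $v_0$, and an integer point splits as $z=x+y$.
Off $v_0$, each coordinate of $y$ is that of $z$ or $0$. Both sides of the bipartition of $G_2$ have
coordinate sum equal to the height of $y$: the side missing $v_0$ makes this height a known integer,
and the other side then gives $y_{v_0}$. So the splitting is unique and integral, and the series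
multiply (`ehrhartSeries_sup`). It remains to build $G$ by attaching bipartite blocks one at a time
to a connected union of blocks. By maximality, a new block meets the union in at most one vertex
(`IsBlock.eq_of_mem_of_not_le`). The start is $G_0$, or any block if there is no odd cycle. -/

namespace SimpleGraph

variable {V : Type*} {G : SimpleGraph V}

/-! ### Odd closed walks and 2-colourings -/

namespace Walk

lemma exists_closed_subwalk_of_not_isPath {u v : V} (p : G.Walk u v) (hp : ¬ p.IsPath) :
    ∃ (x : V) (a : G.Walk u x) (c : G.Walk x x) (b : G.Walk x v),
      0 < c.length ∧ p.length = a.length + c.length + b.length := by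
  classical
  induction p with
  | nil => exact absurd IsPath.nil hp
  | @cons u w v h p ih =>
    by_cases hpp : p.IsPath
    · have hu : u ∈ p.support := by
        by_contra hu
        exact hp (hpp.cons hu)
      refine ⟨u, nil, cons h (p.takeUntil u hu), p.dropUntil u hu, by simp, ?_⟩
      have := congrArg length (p.take_spec hu)
      rw [length_append] at this
      simp only [length_cons, length_nil]
      omega
    · obtain ⟨x, a, c, b, hc, hl⟩ := ih hpp
      refine ⟨x, cons h a, c, b, hc, ?_⟩
      simp only [length_cons]
      omega

/-- A closed walk of odd length forces a cycle of odd length. -/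
lemma hasOddCycle_of_odd_length {u : V} (w : G.Walk u u) (hw : Odd w.length) :
    HasOddCycle G := by
  induction hn : w.length using Nat.strong_induction_on generalizing u with
  | _ n ih =>
    subst hn
    cases w with
    | nil => simp at hw
    | @cons _ v _ h p =>
      by_cases hp : p.IsPath
      · refine ⟨u, cons h p, ?_, hw⟩
        rw [cons_isCycle_iff]
        refine ⟨hp, fun he => ?_⟩
        -- A path from `v` to `u` using the edge `uv` has length 1, so `w` would have length 2.
        rw [Sym2.eq_swap] at he
        rw [length_cons, hp.length_eq_one_of_mem_edges he] at hw
        exact absurd hw (by decide)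
      · obtain ⟨x, a, c, b, hc, hl⟩ := p.exists_closed_subwalk_of_not_isPath hp
        -- Cutting out `c` leaves two shorter closed walks whose lengths add up to that of `w`, so
        -- one of them is odd.
        by_cases hco : Odd c.length
        · exact ih c.length (by rw [length_cons]; omega) c hco rfl
        · refine ih (cons h (a.append b)).length ?_ (cons h (a.append b)) ?_ rfl
          · simp only [length_cons, length_append]; omega
          · simp only [length_cons, length_append] at hw ⊢
            rw [Nat.odd_iff] at hw hco ⊢
            omega

end Walk

lemma colorable_two_of_not_hasOddCycle (h : ¬ HasOddCycle G) : G.Colorable 2 := by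
  rw [two_colorable_iff_forall_loop_even]
  intro u w
  by_contra hw
  exact h (w.hasOddCycle_of_odd_length (Nat.not_even_iff_odd.1 hw))

lemma hasOddCycle_of_coe {H : G.Subgraph} (h : HasOddCycle H.coe) : HasOddCycle G := by
  obtain ⟨v, c, -, ho⟩ := h
  exact Walk.hasOddCycle_of_odd_length (c.map H.hom) (by rwa [Walk.length_map])

namespace Subgraph

variable {B C H K : G.Subgraph}

lemma deleteVerts_sup (s : Set V) :
    (H ⊔ K).deleteVerts s = H.deleteVerts s ⊔ K.deleteVerts s := by
  ext x y
  · simp only [deleteVerts_verts, verts_sup]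
    rw [Set.union_sdiff_distrib]
  · simp only [deleteVerts_adj, sup_adj, verts_sup, Set.mem_union]
    have := @H.edge_vert x y
    have := @K.edge_vert x y
    have := fun h : H.Adj x y => H.edge_vert h.symm
    have := fun h : K.Adj x y => K.edge_vert h.symm
    tauto

lemma Preconnected.of_le_of_forall_walk (hK : K.Preconnected) (hle : K ≤ H)
    (h : ∀ x ∈ H.verts, ∃ y ∈ K.verts, ∃ p : G.Walk x y, p.toSubgraph ≤ H) :
    H.Preconnected := by
  rw [preconnected_iff_forall_exists_walk_subgraph]
  intro x x' hx hx'
  obtain ⟨y, hy, p, hp⟩ := h x hx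
  obtain ⟨y', hy', p', hp'⟩ := h x' hx'
  obtain ⟨q, hq⟩ := (K.preconnected_iff_forall_exists_walk_subgraph.1 hK) hy hy'
  refine ⟨(p.append q).append p'.reverse, ?_⟩
  simp only [Walk.toSubgraph_append, Walk.toSubgraph_reverse]
  exact sup_le (sup_le hp (hq.trans hle)) hp'

lemma le_deleteVerts_of_notMem {v : V} (hle : K ≤ H) (hv : v ∉ K.verts) :
    K ≤ H.deleteVerts {v} := by
  refine ⟨fun x hx => ⟨hle.1 hx, fun h => hv (h ▸ hx)⟩, fun x y hxy => ?_⟩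
  rw [deleteVerts_adj]
  have hx := K.edge_vert hxy
  have hy := K.edge_vert hxy.symm
  exact ⟨hle.1 hx, fun h => hv (h ▸ hx), hle.1 hy, fun h => hv (h ▸ hy), hle.2 hxy⟩

end Subgraph

end SimpleGraph

/-! ### Blocks and how they meet -/

namespace EdgePolytope

open SimpleGraph Subgraph

variable {V : Type*} {G : SimpleGraph V} {B C H K : G.Subgraph}

lemma isBiconnected_singletonSubgraph (v : V) : IsBiconnected (G.singletonSubgraph v) := by
  refine ⟨singletonSubgraph_connected, fun w => ?_⟩
  rw [Subgraph.preconnected_iff]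
  rintro ⟨x, hx⟩ ⟨y, hy⟩
  obtain rfl : x = v := hx.1
  obtain rfl : y = x := hy.1
  rfl

lemma isBiconnected_subgraphOfAdj {u v : V} (h : G.Adj u v) :
    IsBiconnected (G.subgraphOfAdj h) := by
  refine ⟨subgraphOfAdj_connected h, fun w => ?_⟩
  by_cases hw : w ∈ (G.subgraphOfAdj h).verts
  · rw [Subgraph.preconnected_iff]
    rintro ⟨x, hx, hxw⟩ ⟨y, hy, hyw⟩
    have : x = y := by
      simp only [subgraphOfAdj_verts, Set.mem_insert_iff, Set.mem_singleton_iff] at hw hx hy hxw hyw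
      grind
    subst this
    rfl
  · have : (G.subgraphOfAdj h).deleteVerts {w} = G.subgraphOfAdj h :=
      le_antisymm deleteVerts_le (le_deleteVerts_of_notMem le_rfl hw)
    rw [this]
    exact (subgraphOfAdj_connected h).preconnected

/-- Deleting one vertex leaves at least one of `u`, `w` to join the two parts. -/
lemma IsBiconnected.sup (hB : IsBiconnected B) (hC : IsBiconnected C) {u w : V} (huw : u ≠ w)
    (huB : u ∈ B.verts) (hwB : w ∈ B.verts) (huC : u ∈ C.verts) (hwC : w ∈ C.verts) :
    IsBiconnected (B ⊔ C) := by
  refine ⟨connected_sup hB.1.preconnected hC.1.preconnected ⟨u, huB, huC⟩, fun v => ?_⟩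
  rw [deleteVerts_sup]
  refine (connected_sup (hB.2 v) (hC.2 v) ?_).preconnected
  by_cases huv : u = v
  · exact ⟨w, ⟨hwB, fun h => huw (huv.trans h.symm)⟩, ⟨hwC, fun h => huw (huv.trans h.symm)⟩⟩
  · exact ⟨u, ⟨huB, huv⟩, ⟨huC, huv⟩⟩

/-- Adding an ear: a deleted vertex other than `x` lies on at most one of the two arcs of the path
at `x`, so the other arc still leads from `x` to `B`. -/
lemma IsBiconnected.sup_toSubgraph_of_isPath (hB : IsBiconnected B) {u w : V}
    (huB : u ∈ B.verts) (hwB : w ∈ B.verts) {p : G.Walk u w} (hp : p.IsPath) :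
    IsBiconnected (B ⊔ p.toSubgraph) := by
  classical
  refine ⟨connected_sup hB.1.preconnected p.toSubgraph_connected.preconnected
    ⟨u, huB, p.start_mem_verts_toSubgraph⟩, fun v => ?_⟩
  refine (hB.2 v).of_le_of_forall_walk (deleteVerts_mono le_sup_left) fun x hx => ?_
  obtain ⟨hx, hxv⟩ := hx
  by_cases hxB : x ∈ B.verts
  · refine ⟨x, ⟨hxB, hxv⟩, Walk.nil, ?_⟩
    refine le_deleteVerts_of_notMem ?_ ?_
    · simp [Walk.toSubgraph, hxB]
    · simpa [Walk.toSubgraph, eq_comm] using hxv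
  · have hxp : x ∈ p.support := by
      rcases hx with hx | hx
      · exact absurd hx hxB
      · exact p.mem_verts_toSubgraph.1 hx
    have hspec := p.take_spec hxp
    have hsub : (p.takeUntil x hxp).toSubgraph ⊔ (p.dropUntil x hxp).toSubgraph
        = p.toSubgraph := by
      rw [← Walk.toSubgraph_append, hspec]
    by_cases hv : v ∈ (p.takeUntil x hxp).support
    · have hv' : v ∉ (p.dropUntil x hxp).support := by
        intro hv'
        have hnd := hp.support_nodup
        rw [← hspec, Walk.support_append] at hnd
        have hmem : v ∈ (p.dropUntil x hxp).support.tail := by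
          rw [← Walk.cons_tail_support, List.mem_cons] at hv'
          exact hv'.resolve_left fun h => hxv h.symm
        exact List.disjoint_of_nodup_append hnd hv hmem
      refine ⟨w, ⟨hwB, fun h => hv' ?_⟩, p.dropUntil x hxp, ?_⟩
      · rw [← (show w = v from h)]; exact Walk.end_mem_support _
      · refine le_deleteVerts_of_notMem ((le_sup_right.trans hsub.le).trans le_sup_right) ?_
        rwa [Walk.mem_verts_toSubgraph]
    · refine ⟨u, ⟨huB, fun h => hv ?_⟩, (p.takeUntil x hxp).reverse, ?_⟩
      · rw [← (show u = v from h)]; exact Walk.start_mem_support _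
      · rw [Walk.toSubgraph_reverse]
        refine le_deleteVerts_of_notMem ((le_sup_left.trans hsub.le).trans le_sup_right) ?_
        rwa [Walk.mem_verts_toSubgraph]

lemma IsBlock.eq_of_mem (hB : IsBlock B) (hC : IsBlock C) {u w : V} (huw : u ≠ w)
    (huB : u ∈ B.verts) (hwB : w ∈ B.verts) (huC : u ∈ C.verts) (hwC : w ∈ C.verts) :
    B = C := by
  have h := hB.prop.sup hC.prop huw huB hwB huC hwC
  rw [hB.eq_of_le h le_sup_left]
  exact (hC.eq_of_le h le_sup_right).symm

/-- A block contained in a union of blocks at a common edge is a member of the union. -/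
lemma IsBlock.mem_of_adj {S : Set G.Subgraph} (hS : ∀ C ∈ S, IsBlock C) (hB : IsBlock B)
    {x y : V} (hxy : B.Adj x y) (h : (sSup S).Adj x y) : B ∈ S := by
  rw [Subgraph.sSup_adj] at h
  obtain ⟨C, hC, hadj⟩ := h
  rwa [hB.eq_of_mem (hS C hC) hxy.ne (B.edge_vert hxy) (B.edge_vert hxy.symm)
    (C.edge_vert hadj) (C.edge_vert hadj.symm)]

/-- A block not contained in a connected union of blocks meets it in at most one vertex. -/
lemma IsBlock.eq_of_mem_of_not_le {S : Set G.Subgraph} (hS : ∀ C ∈ S, IsBlock C)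
    (hconn : (sSup S).Connected) (hB : IsBlock B) (hle : ¬ B ≤ sSup S) {u w : V}
    (huB : u ∈ B.verts) (hwB : w ∈ B.verts) (hu : u ∈ (sSup S).verts)
    (hw : w ∈ (sSup S).verts) : u = w := by
  classical
  by_contra huw
  obtain ⟨p, hp⟩ := ((sSup S).connected_iff_forall_exists_walk_subgraph.1 hconn).2 hu hw
  have hq : p.bypass.toSubgraph ≤ sSup S := Walk.toSubgraph_bypass_le_toSubgraph.trans hp
  -- Maximality of `B` absorbs the path as an ear; its first edge is then common to `B` and a block
  -- in `S`.
  have hqB : p.bypass.toSubgraph ≤ B := by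
    rw [hB.eq_of_le (hB.prop.sup_toSubgraph_of_isPath huB hwB p.bypass_isPath) le_sup_left]
    exact le_sup_right
  have hadj := p.bypass.toSubgraph_adj_snd (Walk.not_nil_of_ne huw)
  exact hle (le_sSup (hB.mem_of_adj hS (hqB.2 hadj) (hq.2 hadj)))

lemma IsBiconnected.exists_isBlock [Finite V] (hB : IsBiconnected B) :
    ∃ C, IsBlock C ∧ B ≤ C := by
  obtain ⟨C, hle, hC⟩ := (Set.toFinite {C : G.Subgraph | IsBiconnected C}).exists_le_maximal hB
  exact ⟨C, hC, hle⟩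

lemma exists_isBlock_adj [Finite V] {x y : V} (h : G.Adj x y) :
    ∃ C : G.Subgraph, IsBlock C ∧ C.Adj x y := by
  obtain ⟨C, hC, hle⟩ := (isBiconnected_subgraphOfAdj h).exists_isBlock
  exact ⟨C, hC, hle.2 (by simp)⟩

lemma eq_top_of_forall_isBlock_le [Finite V] (h : ∀ B : G.Subgraph, IsBlock B → B ≤ H) :
    H = ⊤ := by
  rw [eq_top_iff]
  refine ⟨fun x _ => ?_, fun x y hxy => ?_⟩
  · obtain ⟨C, hC, hle⟩ := (isBiconnected_singletonSubgraph (G := G) x).exists_isBlock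
    exact (h C hC).1 (hle.1 rfl)
  · obtain ⟨C, hC, hadj⟩ := exists_isBlock_adj hxy
    exact (h C hC).2 hadj

/-- If `H` misses a vertex, some edge leaves `H`, and the block of that edge works; otherwise `B`
itself does. -/
lemma exists_isBlock_not_le_meeting [Finite V] (hG : G.Connected) (hH : H.verts.Nonempty)
    (hB : IsBlock B) (hle : ¬ B ≤ H) :
    ∃ C : G.Subgraph, IsBlock C ∧ ¬ C ≤ H ∧ ∃ v ∈ H.verts, v ∈ C.verts := by
  obtain ⟨a, ha⟩ := hH
  by_cases huniv : ∀ x, x ∈ H.verts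
  · obtain ⟨b, hb⟩ := hB.prop.1.nonempty
    exact ⟨B, hB, hle, b, huniv b, hb⟩
  · push Not at huniv
    obtain ⟨b, hb⟩ := huniv
    obtain ⟨p⟩ := hG.preconnected a b
    obtain ⟨d, -, hd, hd'⟩ := p.exists_boundary_dart H.verts ha hb
    obtain ⟨C, hC, hadj⟩ := exists_isBlock_adj d.adj
    exact ⟨C, hC, fun h => hd' (h.1 (C.edge_vert hadj.symm)), d.fst, hd, C.edge_vert hadj⟩

lemma IsBlock.le_sSup_sup_iff {S : Set G.Subgraph} (hS : ∀ D ∈ S, IsBlock D)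
    (hB : IsBlock B) (hC : IsBlock C) : C ≤ sSup S ⊔ B ↔ C ≤ sSup S ∨ C = B := by
  constructor
  · intro h
    by_cases hadj : ∃ x y, C.Adj x y
    · obtain ⟨x, y, hxy⟩ := hadj
      have : C ∈ insert B S := by
        refine hC.mem_of_adj (S := insert B S) ?_ hxy ?_
        · rintro D (rfl | hD)
          exacts [hB, hS D hD]
        · rw [sSup_insert, sup_comm]
          exact h.2 hxy
      rcases this with h | h
      exacts [Or.inr h, Or.inl (le_sSup h)]
    -- A block without edges is a single vertex, so it lies in whichever part contains that vertex.
    · push Not at hadj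
      obtain ⟨v, hv⟩ := hC.prop.1.nonempty
      have hsub : ∀ x ∈ C.verts, x = v := by
        intro x hx
        by_contra hne
        have : Nontrivial C.verts := ⟨⟨x, hx⟩, ⟨v, hv⟩, fun h => hne (congrArg Subtype.val h)⟩
        obtain ⟨y, hy⟩ := hC.prop.1.preconnected.exists_adj_of_nontrivial ⟨x, hx⟩
        exact hadj _ _ hy
      have hle : ∀ D : G.Subgraph, v ∈ D.verts → C ≤ D := fun D hD =>
        ⟨fun x hx => hsub x hx ▸ hD, fun x y hxy => absurd hxy (hadj x y)⟩
      rcases h.1 hv with h | h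
      · exact Or.inl (hle _ h)
      · exact Or.inr (hC.eq_of_le hB.prop (hle _ h))
  · rintro (h | rfl)
    exacts [h.trans le_sup_left, le_sup_right]

end EdgePolytope

namespace EdgePolytope

open SimpleGraph

variable {V : Type*}

/-! ### The cone over the edge polytope and gluing at a vertex -/

section Cone

variable [Fintype V] {G G₁ G₂ : SimpleGraph V} {t : ℝ} {x : V → ℝ}

/-- The slice at height `t` of the cone spanned by the edge polytope, given by nonnegative
weights on the ordered edges. -/
def coneSlice (G : SimpleGraph V) (t : ℝ) : Set (V → ℝ) :=
  {x | ∃ w : V → V → ℝ, (∀ u v, 0 ≤ w u v) ∧ (∀ u v, ¬ G.Adj u v → w u v = 0) ∧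
    ∑ u, ∑ v, w u v = t ∧ ∀ s, x s = ∑ v, (w s v + w v s)}

lemma nonneg_of_mem_coneSlice (hx : x ∈ coneSlice G t) : 0 ≤ t := by
  obtain ⟨w, hw, -, rfl, -⟩ := hx
  exact Finset.sum_nonneg fun u _ => Finset.sum_nonneg fun v _ => hw u v

lemma apply_nonneg_of_mem_coneSlice (hx : x ∈ coneSlice G t) (s : V) : 0 ≤ x s := by
  obtain ⟨w, hw, -, -, hx⟩ := hx
  rw [hx]
  exact Finset.sum_nonneg fun v _ => add_nonneg (hw s v) (hw v s)

lemma sum_eq_of_mem_coneSlice (hx : x ∈ coneSlice G t) : ∑ s, x s = 2 * t := by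
  obtain ⟨w, -, -, rfl, hx⟩ := hx
  simp_rw [hx, Finset.sum_add_distrib]
  rw [Finset.sum_comm (f := fun s v => w v s)]
  ring

lemma apply_eq_zero_of_mem_coneSlice (hx : x ∈ coneSlice G t) {s : V} (hs : ∀ v, ¬ G.Adj s v) :
    x s = 0 := by
  obtain ⟨w, -, hw, -, hx⟩ := hx
  rw [hx]
  refine Finset.sum_eq_zero fun v _ => ?_
  rw [hw s v (hs v), hw v s fun h => hs v h.symm, add_zero]

/-- Each side of a bipartition carries the height. -/
lemma sum_filter_eq_of_mem_coneSlice (hx : x ∈ coneSlice G t) (p : V → Prop) [DecidablePred p]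
    (hp : ∀ u v, G.Adj u v → (p u ↔ ¬ p v)) : ∑ s with p s, x s = t := by
  obtain ⟨w, -, hw, rfl, hx⟩ := hx
  rw [Finset.sum_filter]
  have : ∀ s, (if p s then x s else 0)
      = ∑ v, (if p s then w s v else 0) + ∑ v, (if p s then w v s else 0) := by
    intro s
    split_ifs
    · rw [hx, Finset.sum_add_distrib]
    · simp
  simp_rw [this, Finset.sum_add_distrib]
  rw [Finset.sum_comm (f := fun s v => if p s then w v s else 0), ← Finset.sum_add_distrib]
  refine Finset.sum_congr rfl fun u _ => ?_
  rw [← Finset.sum_add_distrib]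
  refine Finset.sum_congr rfl fun v _ => ?_
  -- Exactly one end of an edge satisfies `p`, so its weight is counted once.
  by_cases h : G.Adj u v
  · have := hp u v h
    by_cases hu : p u
    · simp [hu, this.1 hu]
    · have hv : p v := by tauto
      simp [hu, hv]
  · simp [hw u v h]

lemma mem_coneSlice_zero : x ∈ coneSlice G 0 ↔ x = 0 := by
  constructor
  · intro hx
    have := sum_eq_of_mem_coneSlice hx
    rw [mul_zero, Finset.sum_eq_zero_iff_of_nonneg
      fun s _ => apply_nonneg_of_mem_coneSlice hx s] at this
    exact funext fun s => this s (Finset.mem_univ s)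
  · rintro rfl
    exact ⟨0, by simp, by simp, by simp, by simp⟩

lemma mem_coneSlice_sup : x ∈ coneSlice (G₁ ⊔ G₂) t ↔
    ∃ t₁ t₂ x₁ x₂, x₁ ∈ coneSlice G₁ t₁ ∧ x₂ ∈ coneSlice G₂ t₂ ∧ t₁ + t₂ = t ∧ x₁ + x₂ = x := by
  classical
  constructor
  · rintro ⟨w, hw, hw0, rfl, hx⟩
    -- Edges common to both graphs give all their weight to `G₁`.
    refine ⟨_, _, fun s => ∑ v, ((if G₁.Adj s v then w s v else 0)
        + (if G₁.Adj v s then w v s else 0)),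
      fun s => ∑ v, ((if G₁.Adj s v then 0 else w s v) + (if G₁.Adj v s then 0 else w v s)),
      ⟨fun u v => if G₁.Adj u v then w u v else 0, ?_, ?_, rfl, fun _ => rfl⟩,
      ⟨fun u v => if G₁.Adj u v then 0 else w u v, ?_, ?_, rfl, fun _ => rfl⟩, ?_, ?_⟩
    · intro u v; dsimp only; split_ifs <;> simp [hw]
    · intro u v h; simp [h]
    · intro u v; dsimp only; split_ifs <;> simp [hw]
    · intro u v h
      dsimp only
      split_ifs with h1
      · rfl
      · exact hw0 u v (by simp [h, h1])
    · simp_rw [← Finset.sum_add_distrib]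
      refine Finset.sum_congr rfl fun u _ => Finset.sum_congr rfl fun v _ => ?_
      split_ifs <;> simp
    · funext s
      rw [Pi.add_apply, hx, ← Finset.sum_add_distrib]
      refine Finset.sum_congr rfl fun v _ => ?_
      split_ifs <;> ring
  · rintro ⟨t₁, t₂, x₁, x₂, ⟨w, hw, hw0, rfl, hx⟩, ⟨w', hw', hw0', rfl, hx'⟩, rfl, rfl⟩
    refine ⟨w + w', fun u v => add_nonneg (hw u v) (hw' u v), fun u v h => ?_, ?_, fun s => ?_⟩
    · rw [sup_adj, not_or] at h
      simp [hw0 u v h.1, hw0' u v h.2]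
    · simp [Finset.sum_add_distrib]
    · rw [Pi.add_apply, hx, hx', ← Finset.sum_add_distrib]
      refine Finset.sum_congr rfl fun v _ => ?_
      simp only [Pi.add_apply]
      ring

lemma convex_coneSlice (G : SimpleGraph V) (t : ℝ) : Convex ℝ (coneSlice G t) := by
  rintro x ⟨w, hw, hw0, rfl, hx⟩ y ⟨w', hw', hw0', ht, hy⟩ a b ha hb hab
  refine ⟨a • w + b • w', fun u v => ?_, fun u v h => ?_, ?_, fun s => ?_⟩
  · have := hw u v
    have := hw' u v
    simp only [Pi.add_apply, Pi.smul_apply, smul_eq_mul]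
    positivity
  · simp [hw0 u v h, hw0' u v h]
  · simp only [Pi.add_apply, Pi.smul_apply, smul_eq_mul, Finset.sum_add_distrib,
      ← Finset.mul_sum, ht]
    rw [← add_mul, hab, one_mul]
  · simp only [Pi.add_apply, Pi.smul_apply, smul_eq_mul, hx, hy]
    rw [Finset.mul_sum, Finset.mul_sum, ← Finset.sum_add_distrib]
    exact Finset.sum_congr rfl fun v _ => by ring

lemma edgePolytope_eq_coneSlice (G : SimpleGraph V) : edgePolytope G = coneSlice G 1 := by
  classical
  refine Set.Subset.antisymm (convexHull_min ?_ (convex_coneSlice G 1)) ?_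
  · rintro _ ⟨u, v, h, rfl⟩
    refine ⟨fun a b => if a = u ∧ b = v then 1 else 0, fun a b => ?_, fun a b hab => ?_, ?_,
      fun s => ?_⟩
    · dsimp only; split_ifs <;> simp
    · refine if_neg ?_
      rintro ⟨rfl, rfl⟩
      exact hab h
    · simp [ite_and]
    · simp [ite_and, Finset.sum_add_distrib, Pi.single_apply]
  · rintro x ⟨w, hw, hw0, ht, hx⟩
    have hx' : x = ∑ p : V × V, w p.1 p.2 •
        ((Pi.single p.1 1 + Pi.single p.2 1 : V → ℝ)) := by
      funext s
      rw [hx, Fintype.sum_prod_type, Finset.sum_apply]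
      simp only [Finset.sum_apply, Pi.smul_apply, Pi.add_apply, Pi.single_apply, smul_eq_mul,
        mul_add, mul_ite, mul_one, mul_zero, Finset.sum_add_distrib]
      rw [Finset.sum_comm (f := fun u v => if s = u then w u v else 0)]
      simp
    have hsum : ∑ p : V × V, w p.1 p.2 = 1 := by rw [Fintype.sum_prod_type]; exact ht
    rw [hx', ← Finset.sum_filter_of_ne (p := fun p : V × V => G.Adj p.1 p.2)]
    · refine (convex_convexHull ℝ _).sum_mem (fun p _ => hw _ _) ?_ ?_
      · rw [Finset.sum_filter_of_ne, hsum]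
        intro p _ hp
        by_contra h
        exact hp (hw0 _ _ h)
      · intro p hp
        exact subset_convexHull ℝ _ ⟨p.1, p.2, (Finset.mem_filter.1 hp).2, rfl⟩
    · intro p _ hp
      by_contra h
      exact hp (by rw [hw0 _ _ h, zero_smul])

lemma smul_mem_coneSlice {c : ℝ} (hc : 0 ≤ c) (hx : x ∈ coneSlice G t) :
    c • x ∈ coneSlice G (c * t) := by
  obtain ⟨w, hw, hw0, rfl, hx⟩ := hx
  refine ⟨c • w, fun u v => mul_nonneg hc (hw u v), fun u v h => ?_, ?_, fun s => ?_⟩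
  · simp [hw0 u v h]
  · simp [Finset.mul_sum]
  · simp [hx, Finset.mul_sum, mul_add]

lemma smul_edgePolytope (G : SimpleGraph V) (ht : 0 < t) :
    t • edgePolytope G = coneSlice G t := by
  rw [edgePolytope_eq_coneSlice]
  ext x
  rw [Set.mem_smul_set]
  constructor
  · rintro ⟨y, hy, rfl⟩
    simpa using smul_mem_coneSlice ht.le hy
  · intro hx
    refine ⟨t⁻¹ • x, ?_, smul_inv_smul₀ ht.ne' x⟩
    simpa [ht.ne'] using smul_mem_coneSlice (inv_nonneg.2 ht.le) hx

/-- The integer points of the cone over the edge polytope at height `m`. -/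
def latticePoints (G : SimpleGraph V) (m : ℕ) : Set (V → ℤ) :=
  {z | (fun v => (z v : ℝ)) ∈ coneSlice G m}

/-- The slice at height 0 is always the origin alone, matching the convention at `m = 0` even for
edgeless graphs, whose polytope is empty. -/
lemma ehrhartCount_eq_ncard (G : SimpleGraph V) (m : ℕ) :
    ehrhartCount G m = (latticePoints G m).ncard := by
  unfold ehrhartCount latticePoints
  split_ifs with hm
  · subst hm
    rw [eq_comm, Set.ncard_eq_one]
    refine ⟨0, Set.ext fun z => ?_⟩
    rw [Set.mem_ofPred_eq, Nat.cast_zero, mem_coneSlice_zero, Set.mem_singleton_iff]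
    simp [funext_iff]
  · rw [smul_edgePolytope G (by positivity)]

lemma finite_latticePoints (G : SimpleGraph V) (m : ℕ) : (latticePoints G m).Finite := by
  classical
  refine (Set.finite_Icc (0 : V → ℤ) (fun _ => 2 * m)).subset fun z hz => ?_
  refine ⟨fun s => ?_, fun s => ?_⟩
  · have := apply_nonneg_of_mem_coneSlice hz s
    exact_mod_cast this
  · have h := Finset.single_le_sum (f := fun v => (z v : ℝ))
      (fun v _ => apply_nonneg_of_mem_coneSlice hz v) (Finset.mem_univ s)
    rw [sum_eq_of_mem_coneSlice hz] at h
    exact_mod_cast h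

/-- Heights and points on a bipartite graph are determined by all coordinates but one. -/
lemma eq_of_mem_coneSlice_of_colorable (hG : G.Colorable 2) {v₀ : V} {t t' : ℝ} {x y : V → ℝ}
    (hx : x ∈ coneSlice G t) (hy : y ∈ coneSlice G t') (h : ∀ s, s ≠ v₀ → x s = y s) :
    t = t' ∧ x = y := by
  classical
  obtain ⟨c⟩ := hG
  have hp : ∀ u v, G.Adj u v → (c u = c v₀ ↔ ¬ c v = c v₀) := fun u v huv => by
    have := c.valid huv
    omega
  have hp' : ∀ u v, G.Adj u v → (¬ c u = c v₀ ↔ ¬ ¬ c v = c v₀) := fun u v huv => by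
    rw [hp u v huv]
  -- The side avoiding `v₀` only involves coordinates where `x` and `y` agree.
  have ht : t = t' := by
    rw [← sum_filter_eq_of_mem_coneSlice hx _ hp', ← sum_filter_eq_of_mem_coneSlice hy _ hp']
    refine Finset.sum_congr rfl fun s hs => h s ?_
    rintro rfl
    exact (Finset.mem_filter.1 hs).2 rfl
  refine ⟨ht, funext fun s => ?_⟩
  by_cases hs : s = v₀
  · subst hs
    have hxs := sum_filter_eq_of_mem_coneSlice hx _ hp
    have hmem : s ∈ ({a | c a = c s} : Finset V) := Finset.mem_filter.2 ⟨Finset.mem_univ s, rfl⟩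
    rw [ht, ← sum_filter_eq_of_mem_coneSlice hy _ hp,
      ← Finset.add_sum_erase _ _ hmem, ← Finset.add_sum_erase _ y hmem,
      Finset.sum_congr rfl fun a ha => h a (Finset.ne_of_mem_erase ha)] at hxs
    exact add_right_cancel hxs
  · exact h s hs

/-- On a bipartite graph, integrality of all coordinates but one implies integrality of the
remaining coordinate and of the height. -/
lemma exists_int_of_mem_coneSlice_of_colorable (hG : G.Colorable 2) {v₀ : V}
    (hx : x ∈ coneSlice G t) {z : V → ℤ} (h : ∀ s, s ≠ v₀ → x s = z s) :
    ∃ (m : ℕ) (y : V → ℤ), t = m ∧ x = fun s => (y s : ℝ) := by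
  classical
  obtain ⟨c⟩ := hG
  have hp : ∀ u v, G.Adj u v → (c u = c v₀ ↔ ¬ c v = c v₀) := fun u v huv => by
    have := c.valid huv
    omega
  have hp' : ∀ u v, G.Adj u v → (¬ c u = c v₀ ↔ ¬ ¬ c v = c v₀) := fun u v huv => by
    rw [hp u v huv]
  have ht : t = ((∑ s with ¬ c s = c v₀, z s : ℤ) : ℝ) := by
    rw [← sum_filter_eq_of_mem_coneSlice hx _ hp', Int.cast_sum]
    refine Finset.sum_congr rfl fun s hs => h s ?_
    rintro rfl
    exact (Finset.mem_filter.1 hs).2 rfl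
  set k : ℤ := ∑ s with ¬ c s = c v₀, z s with hk
  have hk0 : 0 ≤ k := by
    have := nonneg_of_mem_coneSlice hx
    rw [ht] at this
    exact_mod_cast this
  have hx0 : x v₀ = ((k - ∑ s ∈ ({s | c s = c v₀} : Finset V).erase v₀, z s : ℤ) : ℝ) := by
    have hxs := sum_filter_eq_of_mem_coneSlice hx _ hp
    have hmem : v₀ ∈ ({a | c a = c v₀} : Finset V) :=
      Finset.mem_filter.2 ⟨Finset.mem_univ v₀, rfl⟩
    rw [← Finset.add_sum_erase _ _ hmem,
      Finset.sum_congr rfl fun a ha => h a (Finset.ne_of_mem_erase ha), ht] at hxs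
    push_cast
    linarith
  refine ⟨k.toNat, Function.update z v₀ (k - ∑ s ∈ ({s | c s = c v₀} : Finset V).erase v₀, z s),
    ?_, funext fun s => ?_⟩
  · rw [ht, ← Int.cast_natCast, Int.toNat_of_nonneg hk0]
  · by_cases hs : s = v₀
    · subst hs
      rw [hx0, Function.update_self]
    · rw [Function.update_of_ne hs, h s hs]

/-- The Ehrhart series is multiplicative when a bipartite graph is glued at one vertex. -/
theorem ehrhartSeries_sup (hG₂ : G₂.Colorable 2) (v₀ : V)
    (h : ∀ s, s ≠ v₀ → (∀ v, ¬ G₁.Adj s v) ∨ ∀ v, ¬ G₂.Adj s v) :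
    ehrhartSeries (G₁ ⊔ G₂) = ehrhartSeries G₁ * ehrhartSeries G₂ := by
  classical
  ext m
  rw [PowerSeries.coeff_mul]
  simp only [ehrhartSeries, PowerSeries.coeff_mk, ehrhartCount_eq_ncard]
  norm_cast
  have hcard : ∀ (G : SimpleGraph V) (k : ℕ),
      (latticePoints G k).ncard = (finite_latticePoints G k).toFinset.card := fun G k =>
    Set.ncard_eq_toFinset_card _ _
  simp_rw [hcard, ← Finset.card_product]
  rw [← Finset.card_sigma, eq_comm]
  refine Finset.card_bij (fun q _ => q.2.1 + q.2.2) ?_ ?_ ?_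
  · rintro ⟨⟨a, b⟩, x, y⟩ hq
    simp only [Finset.mem_sigma, Finset.HasAntidiagonal.mem_antidiagonal, Finset.mem_product,
      Set.Finite.mem_toFinset, latticePoints, Set.mem_ofPred_eq] at hq ⊢
    obtain ⟨rfl, hx, hy⟩ := hq
    refine mem_coneSlice_sup.2 ⟨a, b, _, _, hx, hy, by push_cast; rfl, ?_⟩
    funext s
    simp
  · rintro ⟨⟨a, b⟩, x, y⟩ hq ⟨⟨a', b'⟩, x', y'⟩ hq' heq
    simp only [Finset.mem_sigma, Finset.HasAntidiagonal.mem_antidiagonal, Finset.mem_product,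
      Set.Finite.mem_toFinset, latticePoints, Set.mem_ofPred_eq] at hq hq' heq
    obtain ⟨hab, hx, hy⟩ := hq
    obtain ⟨hab', hx', hy'⟩ := hq'
    -- Off `v₀`, either both `x` and `x'` vanish or both `y` and `y'` do.
    have key := eq_of_mem_coneSlice_of_colorable hG₂ (v₀ := v₀) hy hy' fun s hs => by
      rcases h s hs with h | h
      · have h1 := apply_eq_zero_of_mem_coneSlice hx h
        have h2 := apply_eq_zero_of_mem_coneSlice hx' h
        have h3 := congrFun heq s
        simp only [Pi.add_apply] at h3
        norm_cast at h1 h2 ⊢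
        omega
      · have h1 := apply_eq_zero_of_mem_coneSlice hy h
        have h2 := apply_eq_zero_of_mem_coneSlice hy' h
        rw [h1, h2]
    obtain ⟨hb, hyy⟩ := key
    have hb : b = b' := by exact_mod_cast hb
    have hyy : y = y' := funext fun s => by exact_mod_cast congrFun hyy s
    subst hb hyy
    obtain rfl : a = a' := by omega
    obtain rfl : x = x' := add_right_cancel heq
    rfl
  · intro z hz
    simp only [Set.Finite.mem_toFinset, latticePoints, Set.mem_ofPred_eq] at hz
    obtain ⟨t₁, t₂, x, y, hx, hy, ht, hxy⟩ := mem_coneSlice_sup.1 hz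
    have hxy' : ∀ s, x s + y s = z s := fun s => congrFun hxy s
    -- Off `v₀`, the `G₂`-part equals `z` where `G₁` has no edge and is 0 elsewhere.
    obtain ⟨b, y', rfl, rfl⟩ := exists_int_of_mem_coneSlice_of_colorable hG₂ (v₀ := v₀) hy
      (z := fun s => if ∀ v, ¬ G₁.Adj s v then z s else 0) fun s hs => by
        split_ifs with h1
        · have := apply_eq_zero_of_mem_coneSlice hx h1
          have := hxy' s
          linarith
        · rw [apply_eq_zero_of_mem_coneSlice hy ((h s hs).resolve_left h1), Int.cast_zero]
    have ht₁ : t₁ = ((m - b : ℤ) : ℝ) := by push_cast; linarith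
    have hle : (b : ℤ) ≤ m := by
      have := nonneg_of_mem_coneSlice hx
      rw [ht₁] at this
      have : (0 : ℤ) ≤ m - b := by exact_mod_cast this
      omega
    have hle' : b ≤ m := by exact_mod_cast hle
    have hx' : x = fun s => ((z s - y' s : ℤ) : ℝ) := funext fun s => by
      have := hxy' s
      push_cast
      linarith
    refine ⟨⟨(m - b, b), (z - y', y')⟩, ?_, by simp⟩
    simp only [Finset.mem_sigma, Finset.HasAntidiagonal.mem_antidiagonal, Finset.mem_product,
      Set.Finite.mem_toFinset, latticePoints, Set.mem_ofPred_eq]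
    refine ⟨by omega, ?_, hy⟩
    rw [hx', ht₁] at hx
    rw [Nat.cast_sub hle']
    simpa using hx

end Cone

/-! ### Extension by zero from the vertex set of a subgraph -/

section SpanningCoe

variable {G : SimpleGraph V} (H : G.Subgraph)

lemma extendByZero_apply {ι η : Type*} (s : ι → η) (f : ι → ℝ) :
    Function.ExtendByZero.linearMap ℝ s f = Function.extend s f 0 := rfl

lemma edgePolytope_spanningCoe : edgePolytope H.spanningCoe =
    Function.ExtendByZero.linearMap ℝ ((↑) : H.verts → V) '' edgePolytope H.coe := by
  classical
  have hsingle : ∀ u : H.verts, Function.extend ((↑) : H.verts → V) (Pi.single u (1 : ℝ)) 0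
      = Pi.single (u : V) 1 := fun u => by
    funext s
    by_cases hs : s ∈ H.verts
    · lift s to H.verts using hs
      rw [Subtype.val_injective.extend_apply]
      simp [Pi.single_apply, Subtype.ext_iff]
    · rw [Function.extend_apply' _ _ _ (by rintro ⟨a, rfl⟩; exact hs a.2), Pi.single_eq_of_ne]
      · rfl
      · rintro rfl
        exact hs u.2
  have hgen : ∀ u v : H.verts, Function.ExtendByZero.linearMap ℝ ((↑) : H.verts → V)
      (Pi.single u 1 + Pi.single v 1) = Pi.single (u : V) 1 + Pi.single (v : V) 1 := fun u v => by
    rw [map_add, extendByZero_apply, extendByZero_apply, hsingle, hsingle]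
  unfold edgePolytope
  rw [LinearMap.image_convexHull]
  congr 1
  ext x
  simp only [Set.mem_ofPred_eq, Set.mem_image]
  constructor
  · rintro ⟨u, v, huv, rfl⟩
    have hadj : H.Adj u v := huv
    refine ⟨_, ⟨⟨u, H.edge_vert hadj⟩, ⟨v, H.edge_vert hadj.symm⟩, hadj, rfl⟩, ?_⟩
    convert hgen _ _
  · rintro ⟨_, ⟨u, v, huv, rfl⟩, rfl⟩
    refine ⟨u, v, huv, ?_⟩
    convert hgen _ _

/-- Vertices outside `H` only add zero coordinates, so all subgraphs can be compared inside the one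
space `V → ℝ`. -/
lemma ehrhartSeries_spanningCoe : ehrhartSeries H.spanningCoe = ehrhartSeries H.coe := by
  unfold ehrhartSeries
  congr 1
  funext m
  unfold ehrhartCount
  split_ifs with hm
  · rfl
  have hcast : ∀ z : H.verts → ℤ, Function.ExtendByZero.linearMap ℝ ((↑) : H.verts → V)
      (fun v => (z v : ℝ)) = fun v => ((Function.extend ((↑) : H.verts → V) z 0 v : ℤ) : ℝ) := by
    intro z
    funext s
    rw [extendByZero_apply]
    by_cases hs : s ∈ H.verts
    · lift s to H.verts using hs
      rw [Subtype.val_injective.extend_apply, Subtype.val_injective.extend_apply]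
    · have hs' : ¬ ∃ a : H.verts, (a : V) = s := by rintro ⟨a, rfl⟩; exact hs a.2
      rw [Function.extend_apply' _ _ _ hs', Function.extend_apply' _ _ _ hs']
      simp
  rw [edgePolytope_spanningCoe, ← image_smul_set,
    ← Set.ncard_image_of_injective _ (Function.extend_injective
      (γ := ℤ) (Subtype.val_injective (p := (· ∈ H.verts))) 0)]
  congr 2
  ext z
  simp only [Set.mem_ofPred_eq, Set.mem_image]
  constructor
  · rintro ⟨x, hx, hxz⟩
    have hz : z = Function.extend ((↑) : H.verts → V) (fun v => z v) 0 := by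
      funext s
      by_cases hs : s ∈ H.verts
      · lift s to H.verts using hs
        rw [Subtype.val_injective.extend_apply]
      · have hs' : ¬ ∃ a : H.verts, (a : V) = s := by rintro ⟨a, rfl⟩; exact hs a.2
        have := congrFun hxz s
        rw [extendByZero_apply, Function.extend_apply' _ _ _ hs'] at this
        rw [Function.extend_apply' _ _ _ hs']
        rw [Pi.zero_apply] at this ⊢
        exact_mod_cast this.symm
    refine ⟨fun v => z v, ?_, hz.symm⟩
    convert hx using 1
    funext v
    have := congrFun hxz v
    rw [extendByZero_apply, Subtype.val_injective.extend_apply] at this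
    exact this.symm
  · rintro ⟨z, hz, rfl⟩
    exact ⟨_, hz, hcast z⟩

end SpanningCoe

end EdgePolytope

/-! ### Attaching the blocks one by one -/

namespace EdgePolytope

open SimpleGraph Subgraph

variable {V : Type*} [Finite V] {G : SimpleGraph V}

lemma mem_blocks {B : G.Subgraph} : B ∈ blocks G ↔ IsBlock B := by
  simp [blocks]

lemma mem_blocksOutside {H B : G.Subgraph} : B ∈ blocksOutside H ↔ IsBlock B ∧ ¬ B ≤ H := by
  simp [blocksOutside]

/-- Attaching a bipartite block to a connected union of blocks multiplies the Ehrhart series. -/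
lemma ehrhartSeries_coe_sup {S : Set G.Subgraph} (hS : ∀ C ∈ S, IsBlock C)
    (hconn : (sSup S).Connected) {B : G.Subgraph} (hB : IsBlock B) (hle : ¬ B ≤ sSup S)
    (hodd : ¬ HasOddCycle B.coe) {v : V} (hv : v ∈ (sSup S).verts) (hvB : v ∈ B.verts) :
    ehrhartSeries (sSup S ⊔ B).coe = ehrhartSeries (sSup S).coe * ehrhartSeries B.coe := by
  have := Fintype.ofFinite V
  classical
  simp only [← ehrhartSeries_spanningCoe]
  have hsup : (sSup S ⊔ B).spanningCoe = (sSup S).spanningCoe ⊔ B.spanningCoe := by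
    ext x y
    simp
  rw [hsup]
  refine ehrhartSeries_sup ?_ v fun s hs => ?_
  · obtain ⟨c⟩ := colorable_two_of_not_hasOddCycle hodd
    -- Vertices outside `B` are isolated here, so their colour is arbitrary.
    refine ⟨⟨fun x => if hx : x ∈ B.verts then c ⟨x, hx⟩ else 0, fun {x y} hxy => ?_⟩⟩
    have hadj : B.Adj x y := hxy
    rw [dif_pos (B.edge_vert hadj), dif_pos (B.edge_vert hadj.symm)]
    exact c.valid hadj
  · by_contra! h
    obtain ⟨⟨x, hx⟩, y, hy⟩ := h
    exact hs (hB.eq_of_mem_of_not_le hS hconn hle (B.edge_vert hy) hvB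
      ((sSup S).edge_vert hx) hv)

/-- The Ehrhart series factors over any connected union of blocks containing all blocks with an
odd cycle. -/
theorem IsConnectedOddCover.ehrhartSeries_eq (hG : G.Connected) {H : G.Subgraph}
    (hH : IsConnectedOddCover H) :
    ehrhartSeries G = ehrhartSeries H.coe * ∏ B ∈ blocksOutside H, ehrhartSeries B.coe := by
  classical
  induction hn : (blocksOutside H).card generalizing H with
  | zero =>
    rw [Finset.card_eq_zero] at hn
    have htop : H = ⊤ := eq_top_of_forall_isBlock_le fun B hB => by
      by_contra hle
      exact Finset.notMem_empty B (hn ▸ mem_blocksOutside.2 ⟨hB, hle⟩)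
    rw [hn, Finset.prod_empty, mul_one, htop, ← ehrhartSeries_spanningCoe,
      Subgraph.spanningCoe_top]
  | succ n ih =>
    obtain ⟨hconn, ⟨S, hS, rfl⟩, hodd⟩ := hH
    obtain ⟨B₀, hB₀⟩ := Finset.card_pos.1 (by omega : 0 < (blocksOutside (sSup S)).card)
    rw [mem_blocksOutside] at hB₀
    obtain ⟨B, hB, hle, v, hv, hvB⟩ :=
      exists_isBlock_not_le_meeting hG hconn.nonempty hB₀.1 hB₀.2
    have hBmem : B ∈ blocksOutside (sSup S) := mem_blocksOutside.2 ⟨hB, hle⟩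
    -- Enlarging the union by `B` swallows no other block, so exactly one factor is used up.
    have herase : blocksOutside (sSup S ⊔ B) = (blocksOutside (sSup S)).erase B := by
      ext C
      rw [Finset.mem_erase, mem_blocksOutside, mem_blocksOutside]
      constructor
      · rintro ⟨hC, h⟩
        rw [hB.le_sSup_sup_iff hS hC, not_or] at h
        exact ⟨h.2, hC, h.1⟩
      · rintro ⟨hne, hC, h⟩
        refine ⟨hC, ?_⟩
        rw [hB.le_sSup_sup_iff hS hC, not_or]
        exact ⟨h, hne⟩
    have hcover : IsConnectedOddCover (sSup S ⊔ B) := by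
      refine ⟨connected_sup hconn.preconnected hB.prop.1.preconnected ⟨v, hv, hvB⟩,
        ⟨insert B S, ?_, by rw [sSup_insert, sup_comm]⟩,
        fun C hC hCo => (hodd C hC hCo).trans le_sup_left⟩
      rintro C (rfl | hC)
      exacts [hB, hS C hC]
    rw [ih hcover (by rw [herase, Finset.card_erase_of_mem hBmem, hn]; rfl), herase,
      ehrhartSeries_coe_sup hS hconn hB hle (fun h => hle (hodd B hB h)) hv hvB, mul_assoc,
      Finset.mul_prod_erase _ (fun C : G.Subgraph => ehrhartSeries C.coe) hBmem]

end EdgePolytope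

theorem theorem3p3 {V : Type*} [Finite V] (G : SimpleGraph V) (hG : G.Connected) :
    (¬ HasOddCycle G → ehrhartSeries G = ∏ B ∈ blocks G, ehrhartSeries B.coe) ∧
    (HasOddCycle G → ∀ G₀ : G.Subgraph, IsOddmentsSubgraph G₀ →
      ehrhartSeries G = ehrhartSeries G₀.coe * ∏ B ∈ blocksOutside G₀, ehrhartSeries B.coe) := by
  classical
  refine ⟨fun hodd => ?_, fun _ G₀ hG₀ => hG₀.prop.ehrhartSeries_eq hG⟩
  obtain ⟨v⟩ := hG.nonempty
  -- Without odd cycles any block is a valid start, and its own series supplies the factor missing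
  -- from `blocksOutside B`.
  obtain ⟨B, hB, -⟩ := (isBiconnected_singletonSubgraph (G := G) v).exists_isBlock
  have hcover : IsConnectedOddCover B :=
    ⟨hB.prop.1, ⟨{B}, by simpa using hB, by simp⟩, fun _ _ h => absurd (SimpleGraph.hasOddCycle_of_coe h) hodd⟩
  have herase : blocksOutside B = (blocks G).erase B := by
    ext C
    rw [Finset.mem_erase, mem_blocksOutside, mem_blocks]
    constructor
    · rintro ⟨hC, hle⟩
      exact ⟨fun h => hle h.le, hC⟩
    · rintro ⟨hne, hC⟩
      exact ⟨hC, fun hle => hne (hC.eq_of_le hB.prop hle)⟩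
  rw [hcover.ehrhartSeries_eq hG, herase,
    Finset.mul_prod_erase _ (fun C : G.Subgraph => ehrhartSeries C.coe) (mem_blocks.2 hB)]
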